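/- \textbf{Theorem (General lower bound).} \emph{Family.} For $n\ge 1$, $\delta\in\mathbb R$ and $v\in\{-1,1\}^n$ let $$H_v^\delta=-\sum_{i=1}^n\left[\sin\left(\tfrac{\pi}{4}+v_i\delta\right)X_i+\cos\left(\tfrac{\pi}{4}+v_i\delta\right)Z_i\right]$$ on $n$ qubits, where $X_i,Z_i$ are the Pauli operators on qubit $i$. For $\epsilon>0$ let $\delta(\epsilon)=\sqrt{45\epsilon/n}$ and $\mathcal H_n^\epsilon=\{H_v^{\delta(\epsilon)}: v\in\{-1,1\}^n\}$. \emph{Sampling oracle.} Let $H=\sum_l\alpha_lP_l$ be the Pauli decomposition of a Hermitian operator, with $\alpha_l>0$ and $P_l$ signed tensor products of Pauli operators. A query to the oracle $\mathcal O_H$ consists of a parameterization $|\theta\rangle=e^{-iA_p\theta_p/2}\cdots e^{-iA_1\theta_1/2}|\Psi\rangle$ (any $p\ge 0$, any $n$-qubit pure state $|\Psi\rangle$, any Hermitian generators $A_j=\sum_k\beta^{(j)}_kQ^{(j)}_k$ with Pauli decompositions normalized in the same way), a parameter $\theta\in\mathbb R^p$, and a finite multiset $S=\{j_1\le\dots\le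 j_r\}$ of elements of $\{1,\dots,p\}$. Put $U_{(j+1):p}=e^{-iA_p\theta_p/2}\cdots e^{-iA_{j+1}\theta_{j+1}/2}$ and $\tilde Q^{(j)}_k=U_{(j+1):p}\,Q^{(j)}_k\,U_{(j+1):p}^\dagger$. With $f(\theta)=\langle\theta|H|\theta\rangle$, $$\frac{\partial^r f}{\partial\theta_{j_1}\cdots\partial\theta_{j_r}}(\theta)=\sum_{k_1,\dots,k_r,l}\beta^{(j_1)}_{k_1}\cdots\beta^{(j_r)}_{k_r}\alpha_l\,\Big\langle\theta\Big|\left(\tfrac i2\right)^r\big[\tilde Q^{(j_1)}_{k_1},[\dots,[\tilde Q^{(j_r)}_{k_r},P_l]\dots]\big]\Big|\theta\Big\rangle .$$ The terms that are trivially zero are removed. These are the terms in which, at some level of the nested commutator, the qubits of $\tilde Q^{(j_s)}_{k_s}$ are disjoint from the union of the qubits of the operators $\tilde Q^{(j_t)}_{k_t}$ $(t>s)$ and $P_l$ inside. Here the qubits of $\tilde Q^{(j)}_k$ are obtained from those of $Q^{(j)}_k$ by going through the pulses $j+1,\dots,p$ in this order and adding the qubits on which $A_i$ acts nontrivially whenever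 they meet the set collected so far (any other pulse commutes through and cancels with its inverse). Let $\Gamma$ be the sum of the coefficients $\beta^{(j_1)}_{k_1}\cdots\beta^{(j_r)}_{k_r}\alpha_l$ of the remaining terms. The oracle samples a remaining term with probability proportional to its coefficient, and obtains from a single Hadamard test a $\pm1$-valued unbiased estimate of the corresponding expectation value: it multiplies out the nested commutator, chooses one of the $2^r$ equally weighted products of Pauli operators and conjugated Pauli operators uniformly at random, and measures the real part of its expectation in $|\theta\rangle$ including the phase $\pm i^r$ (for $r=0$ it measures $P_l$ in $|\theta\rangle$). It outputs $\Gamma$ times the outcome, and it outputs $0$ if no term remains. \emph{Algorithms.} A randomized classical algorithm $\mathcal A$ makes at most $T$ queries to $\mathcal O_H$, each of which may be of any order, use any parameterization and any state, and depend on all earlier answers and on the internal randomness of $\mathcal A$; it then outputs a description of an $n$-qubit pure state $|\psi\rangle$. Its optimization error is $$\mathrm{Err}(\mathcal A,\mathcal H_n^\epsilon)=\sup_{H\in\mathcal H_n^\epsilon}\mathbb E_\psi\left[\langle\psi|H|\psi\rangle-\lambda_{\min}(H)\right],$$ where the expectation is over the randomness of the oracle and of $\mathcal A$. \emph{Claim.}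 There is a universal constant $c>0$ such that for all $n\ge 15$, all $0<\epsilon\le 0.01\,n$ and all $T$: if an algorithm $\mathcal A$ as above makes at most $T$ queries and satisfies $\mathrm{Err}(\mathcal A,\mathcal H_n^\epsilon)\le\epsilon$, then $$T\ \ge\ c\,\frac{n^2}{\epsilon}.$$ -/

import Mathlib

open scoped Matrix ENNReal
open MeasureTheory

noncomputable section

namespace Variational

/-! ### States and operators on `n` qubits -/

/-- Operators on `n` qubits, as matrices in the computational basis `{0,1}ⁿ`. -/
abbrev Op (n : ℕ) : Type := Matrix (Fin n → Fin 2) (Fin n → Fin 2) ℂ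

/-- Normalized pure states on `n` qubits. -/
def PureState (n : ℕ) : Type := {ψ : (Fin n → Fin 2) → ℂ // star ψ ⬝ᵥ ψ = 1}

/-- The number `⟨ψ|M|ψ⟩` for an arbitrary operator `M`. -/
def PureState.sandwich {n : ℕ} (ψ : PureState n) (M : Op n) : ℂ :=
  star ψ.1 ⬝ᵥ (M *ᵥ ψ.1)

/-- The smallest eigenvalue of a Hermitian operator. -/
def lambdaMin {n : ℕ} (H : Op n) : ℝ := sInf (spectrum ℝ H)

/-! ### Pauli operators and Pauli decompositions -/

/-- The labels of the single-qubit Pauli operators (the identity included). -/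
inductive Pauli : Type
  | I | X | Y | Z
  deriving DecidableEq

instance : Fintype Pauli :=
  ⟨{Pauli.I, Pauli.X, Pauli.Y, Pauli.Z}, fun a => by cases a <;> simp⟩

/-- The `2 × 2` matrix of a single-qubit Pauli operator. -/
def Pauli.mat : Pauli → Matrix (Fin 2) (Fin 2) ℂ
  | .I => 1
  | .X => !![0, 1; 1, 0]
  | .Y => !![0, -Complex.I; Complex.I, 0]
  | .Z => !![1, 0; 0, -1]

/-- Labels of the products (tensor products) of Pauli operators on `n` qubits. -/
abbrev PauliString (n : ℕ) : Type := Fin n → Pauli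

/-- The tensor product of Pauli operators with a given label. -/
def PauliString.op {n : ℕ} (s : PauliString n) : Op n :=
  Matrix.of fun x y => ∏ i, (s i).mat (x i) (y i)

/-- The set of qubits on which a product of Pauli operators acts nontrivially. -/
def PauliString.qubits {n : ℕ} (s : PauliString n) : Finset (Fin n) :=
  {i | s i ≠ Pauli.I}

/-- The Pauli operator `a` on qubit `i` (identity on all other qubits). -/
def PauliString.single {n : ℕ} (i : Fin n) (a : Pauli) : PauliString n :=
  Function.update (fun _ => Pauli.I) i a

/-- The coefficient `2⁻ⁿ tr(s A)` of the Pauli product `s` in the Hermitian operator `A`, so that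
`A = ∑ s, pauliCoeff A s • s.op`; it is a real number. -/
def pauliCoeff {n : ℕ} (A : Op n) (s : PauliString n) : ℝ :=
  (s.op * A).trace.re / 2 ^ n

/-- The Pauli product `s` with the sign of its coefficient in `A` absorbed, so that
`A = ∑ s, |pauliCoeff A s| • signedPauli A s` has nonnegative coefficients. -/
def signedPauli {n : ℕ} (A : Op n) (s : PauliString n) : Op n :=
  if 0 ≤ pauliCoeff A s then s.op else -s.op

/-- The set of qubits on which the Hermitian operator `A` acts nontrivially: those on which some
term of its Pauli decomposition does. -/
def opQubits {n : ℕ} (A : Op n) : Finset (Fin n) :=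
  {i | ∃ s : PauliString n, pauliCoeff A s ≠ 0 ∧ s i ≠ Pauli.I}

/-! ### Parameterizations and queries -/

/-- A `p`-pulse state parameterization
`θ ↦ exp(-i A_p θ_p / 2) ⋯ exp(-i A_1 θ_1 / 2) |Ψ⟩`: a starting state and Hermitian generators. -/
structure Parameterization (n p : ℕ) : Type where
  start : PureState n
  gen : Fin p → Op n
  gen_isHermitian : ∀ j, (gen j).IsHermitian

/-- An input to the sampling oracle: a parameterization (with any number `p` of pulses), a
parameter, and a multiset of coordinates, whose cardinality is the order of the query. -/
structure Query (n : ℕ) : Type where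
  p : ℕ
  par : Parameterization n p
  θ : Fin p → ℝ
  S : Multiset (Fin p)

namespace Query

variable {n : ℕ} (q : Query n)

/-- The pulse `exp(-i A_j θ_j / 2)`. -/
def pulse (j : Fin q.p) : Op n :=
  NormedSpace.exp ((-(Complex.I * (q.θ j : ℂ) / 2)) • q.par.gen j)

/-- The pulses in a list applied one after the other, the head of the list first. -/
def pulses (l : List (Fin q.p)) : Op n :=
  l.foldl (fun M j => q.pulse j * M) 1

/-- The pulses that come after pulse `j`, in the order of application. -/
def later (j : Fin q.p) : List (Fin q.p) :=
  (List.finRange q.p).filter (fun i => j < i)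

/-- The coordinates `j₁ ≤ ⋯ ≤ j_r` of the query in nondecreasing order. -/
def coords : List (Fin q.p) := q.S.sort (· ≤ ·)

/-- The order `r` of the query. -/
def order : ℕ := q.coords.length

/-- The coordinate `j_s`. -/
def coord (s : Fin q.order) : Fin q.p := q.coords.get s

/-- The qubits of the conjugated Pauli product `U Q U†`, where `U` consists of the pulses after
pulse `j`: going outwards from `Q`, a pulse that acts on none of the qubits collected so far commutes
through and cancels with its inverse, and any other pulse contributes the qubits it acts on. -/
def cone (j : Fin q.p) (Q : PauliString n) : Finset (Fin n) :=
  (q.later j).foldl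
    (fun R i => if Disjoint (opQubits (q.par.gen i)) R then R else R ∪ opQubits (q.par.gen i))
    Q.qubits

/-- Labels `(k₁, …, k_r, l)` of the terms in the expansion
`∂^r f = ∑ (∏ β) α ⟨(i/2)^r [Q̃_{k₁}, [⋯, [Q̃_{k_r}, P_l]⋯]]⟩` of the derivative of order `r`. -/
abbrev Term : Type := (Fin q.order → PauliString n) × PauliString n

/-- The nested commutator of a term is not trivially zero: at every level, the qubits of the
conjugated Pauli product meet the qubits that occur in the commutator inside. -/
def Survives (t : q.Term) : Prop :=
  ∀ s : Fin q.order, ¬ Disjoint (q.cone (q.coord s) (t.1 s))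
    (t.2.qubits ∪ (Finset.univ.filter (s < ·)).biUnion fun u => q.cone (q.coord u) (t.1 u))

open Classical in
/-- The (nonnegative) coefficient of a term, set to zero if the term is trivially zero. -/
def weight (H : Op n) (t : q.Term) : ℝ :=
  if q.Survives t then
    (∏ s, |pauliCoeff (q.par.gen (q.coord s)) (t.1 s)|) * |pauliCoeff H t.2|
  else 0

/-- The normalization factor of the query: the sum of all coefficients. -/
def normalization (H : Op n) : ℝ := ∑ t, q.weight H t

/-- The conjugated signed Pauli product `Q̃ = U Q U†`, where `U` consists of the pulses after
pulse `j`. -/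
def conjPauli (j : Fin q.p) (s : PauliString n) : Op n :=
  q.pulses (q.later j) * signedPauli (q.par.gen j) s * (q.pulses (q.later j))ᴴ

/-- The product of Pauli operators that occurs for `R` when the nested commutator of a term is
multiplied out: `Q̃_{k_s}` stands to the right of `P_l` for `s ∈ R` and to the left otherwise. -/
def product (H : Op n) (t : q.Term) (R : Finset (Fin q.order)) : Op n :=
  (List.finRange q.order).foldr
    (fun s M => if s ∈ R then M * q.conjPauli (q.coord s) (t.1 s)
      else q.conjPauli (q.coord s) (t.1 s) * M)
    (signedPauli H t.2)

/-! The products above are unitary, so that their Hadamard tests have probabilities. -/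

theorem pauli_mat_isHermitian (a : Pauli) : a.matᴴ = a.mat := by
  cases a <;> ext i j <;> fin_cases i <;> fin_cases j <;> simp [Pauli.mat]

theorem pauli_mat_mul_self (a : Pauli) : a.mat * a.mat = 1 := by
  cases a <;> ext i j <;> fin_cases i <;> fin_cases j <;> simp [Pauli.mat]

theorem pauliString_conjTranspose (s : PauliString n) : s.opᴴ = s.op := by
  ext x y
  simp only [PauliString.op, Matrix.conjTranspose_apply, Matrix.of_apply, star_prod]
  refine Finset.prod_congr rfl fun i _ => ?_
  conv_rhs => rw [← pauli_mat_isHermitian (s i)]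
  rfl

theorem pauliString_mul_self (s : PauliString n) : s.op * s.op = 1 := by
  ext x y
  simp only [PauliString.op, Matrix.mul_apply, Matrix.of_apply, ← Finset.prod_mul_distrib]
  have h := Finset.prod_univ_sum (fun _ : Fin n => (Finset.univ : Finset (Fin 2)))
    (fun i b => (s i).mat (x i) b * (s i).mat b (y i))
  rw [Fintype.piFinset_univ] at h
  rw [← h]
  have h2 : ∀ i, ∑ b, (s i).mat (x i) b * (s i).mat b (y i)
      = (1 : Matrix (Fin 2) (Fin 2) ℂ) (x i) (y i) := fun i => by
    rw [← pauli_mat_mul_self (s i), Matrix.mul_apply]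
  simp only [h2, Matrix.one_apply]
  by_cases hxy : x = y
  · simp [hxy]
  · obtain ⟨i, hi⟩ := Function.ne_iff.mp hxy
    rw [if_neg hxy]
    exact Finset.prod_eq_zero (Finset.mem_univ i) (if_neg hi)

theorem signedPauli_mem (A : Op n) (s : PauliString n) :
    signedPauli A s ∈ Matrix.unitaryGroup (Fin n → Fin 2) ℂ := by
  rw [Matrix.mem_unitaryGroup_iff, Matrix.star_eq_conjTranspose]
  unfold signedPauli
  split_ifs <;> simp [pauliString_conjTranspose, pauliString_mul_self]

theorem pulse_mem (j : Fin q.p) : q.pulse j ∈ Matrix.unitaryGroup (Fin n → Fin 2) ℂ := by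
  rw [Matrix.mem_unitaryGroup_iff, Matrix.star_eq_conjTranspose, pulse, ← Matrix.exp_conjTranspose,
    Matrix.conjTranspose_smul, (q.par.gen_isHermitian j).eq]
  have h : star (-(Complex.I * (q.θ j : ℂ) / 2)) = -(-(Complex.I * (q.θ j : ℂ) / 2)) := by
    simp [neg_div]
  rw [h, neg_smul (-(Complex.I * (q.θ j : ℂ) / 2)), Matrix.exp_neg, Matrix.mul_nonsing_inv]
  exact (Matrix.isUnit_iff_isUnit_det _).mp (Matrix.isUnit_exp _)

theorem pulses_mem (l : List (Fin q.p)) :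
    q.pulses l ∈ Matrix.unitaryGroup (Fin n → Fin 2) ℂ := by
  unfold pulses
  suffices h : ∀ (M : Op n), M ∈ Matrix.unitaryGroup (Fin n → Fin 2) ℂ →
      l.foldl (fun M j => q.pulse j * M) M ∈ Matrix.unitaryGroup (Fin n → Fin 2) ℂ from
    h 1 (one_mem _)
  induction l with
  | nil => exact fun M hM => hM
  | cons j l ih => exact fun M hM => ih _ (mul_mem (q.pulse_mem j) hM)

theorem conjPauli_mem (j : Fin q.p) (s : PauliString n) :
    q.conjPauli j s ∈ Matrix.unitaryGroup (Fin n → Fin 2) ℂ :=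
  mul_mem (mul_mem (q.pulses_mem _) (signedPauli_mem _ _)) (Unitary.star_mem (q.pulses_mem _))

theorem product_mem (H : Op n) (t : q.Term) (R : Finset (Fin q.order)) :
    q.product H t R ∈ Matrix.unitaryGroup (Fin n → Fin 2) ℂ := by
  unfold product
  induction List.finRange q.order with
  | nil => exact signedPauli_mem _ _
  | cons s l ih =>
    rw [List.foldr_cons]
    split_ifs
    · exact mul_mem ih (q.conjPauli_mem _ _)
    · exact mul_mem (q.conjPauli_mem _ _) ih

theorem mulVec_normalized (U : Op n) (hU : U ∈ Matrix.unitaryGroup (Fin n → Fin 2) ℂ)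
    (ψ : (Fin n → Fin 2) → ℂ) (hψ : star ψ ⬝ᵥ ψ = 1) : star (U *ᵥ ψ) ⬝ᵥ (U *ᵥ ψ) = 1 := by
  rw [Matrix.star_mulVec, Matrix.dotProduct_mulVec, Matrix.vecMul_vecMul,
    ← Matrix.star_eq_conjTranspose, Matrix.mem_unitaryGroup_iff'.mp hU, Matrix.vecMul_one, hψ]

theorem norm_sandwich_le (ψ : PureState n) (U : Op n)
    (hU : U ∈ Matrix.unitaryGroup (Fin n → Fin 2) ℂ) : ‖ψ.sandwich U‖ ≤ 1 := by
  have key : ∀ φ : (Fin n → Fin 2) → ℂ, star φ ⬝ᵥ φ = 1 → ‖WithLp.toLp 2 φ‖ = 1 := fun φ hφ => by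
    have h1 : inner ℂ (WithLp.toLp 2 φ) (WithLp.toLp 2 φ) = (1 : ℂ) := by
      rw [EuclideanSpace.inner_toLp_toLp, dotProduct_comm, hφ]
    rw [inner_self_eq_norm_sq_to_K] at h1
    have h2 : ‖WithLp.toLp 2 φ‖ ^ 2 = 1 := Complex.ofReal_injective (by simpa using h1)
    nlinarith [norm_nonneg (WithLp.toLp 2 φ)]
  have h := norm_inner_le_norm (𝕜 := ℂ) (WithLp.toLp 2 ψ.1) (WithLp.toLp 2 (U *ᵥ ψ.1))
  rw [key _ ψ.2, key _ (mulVec_normalized U hU _ ψ.2), EuclideanSpace.inner_toLp_toLp,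
    dotProduct_comm, mul_one] at h
  exact h

/-- The state `|θ⟩` that the query describes. -/
def state : PureState n :=
  ⟨q.pulses (List.finRange q.p) *ᵥ q.par.start.1,
    mulVec_normalized _ (q.pulses_mem _) _ q.par.start.2⟩

/-! ### The sampling oracle -/

/-- The mean `Re (i^r (-1)^|R| ⟨θ| L P_l M |θ⟩)` of the Hadamard test for one product. The
average over all `R` is the expectation of `(i/2)^r` times the nested commutator of the term;
for a query of order `0` it is `⟨θ|P_l|θ⟩`. -/
def hadamardMean (H : Op n) (t : q.Term) (R : Finset (Fin q.order)) : ℝ :=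
  (Complex.I ^ q.order * (-1) ^ R.card * q.state.sandwich (q.product H t R)).re

theorem abs_hadamardMean_le (H : Op n) (t : q.Term) (R : Finset (Fin q.order)) :
    |q.hadamardMean H t R| ≤ 1 := by
  refine (Complex.abs_re_le_norm _).trans ?_
  simpa using norm_sandwich_le q.state _ (q.product_mem H t R)

theorem weight_nonneg (H : Op n) (t : q.Term) : 0 ≤ q.weight H t := by
  unfold weight
  split_ifs
  · positivity
  · exact le_rfl

/-- Sampling a term with probability proportional to its coefficient. -/
def termLaw (H : Op n) (h : q.normalization H ≠ 0) : PMF q.Term :=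
  PMF.ofFintype (fun t => ENNReal.ofReal (q.weight H t / q.normalization H)) (by
    have h0 : 0 ≤ q.normalization H := Finset.sum_nonneg fun t _ => q.weight_nonneg H t
    rw [← ENNReal.ofReal_sum_of_nonneg fun t _ => div_nonneg (q.weight_nonneg H t) h0,
      ← Finset.sum_div, ← normalization, div_self h, ENNReal.ofReal_one])

/-- The law of the outcome of the Hadamard test: `true` stands for `+1` and `false` for `-1`. -/
def hadamardLaw (H : Op n) (t : q.Term) (R : Finset (Fin q.order)) : PMF Bool :=
  PMF.ofFintype (fun b => ENNReal.ofReal ((1 + (if b then 1 else -1) * q.hadamardMean H t R) / 2))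
    (by
      have h := abs_le.mp (q.abs_hadamardMean_le H t R)
      rw [Fintype.sum_bool, ← ENNReal.ofReal_add (by simp; linarith) (by simp; linarith),
        ← ENNReal.ofReal_one]
      congr 1
      simp
      ring)

end Query

open Classical in
/-- The sampling oracle encoding the objective observable `H`: the law of its output on a query.
It samples a term of the expansion of the derivative, and one of the equally weighted products
in the nested commutator of that term, performs one Hadamard test (for order `0`: one
measurement of a Pauli product in the state `|θ⟩`), and multiplies the outcome `±1` by the
normalization factor. If all terms are trivially zero, the output is `0`. -/
def oracle {n : ℕ} (H : Op n) (q : Query n) : PMF ℝ :=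
  if h : q.normalization H ≠ 0 then
    (q.termLaw H h).bind fun t =>
      (PMF.uniformOfFintype (Finset (Fin q.order))).bind fun R =>
        (q.hadamardLaw H t R).map fun b => (if b then 1 else -1) * q.normalization H
  else PMF.pure 0

/-! ### Query algorithms and their error -/

/-- Deterministic adaptive algorithms that make at most `T` oracle queries and output a pure
state: each query, and the output, may depend on all earlier answers of the oracle. -/
inductive Strategy (n : ℕ) : ℕ → Type
  | output {T : ℕ} (ψ : PureState n) : Strategy n T
  | ask {T : ℕ} (q : Query n) (next : ℝ → Strategy n T) : Strategy n (T + 1)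

/-- The law of the output state when the algorithm runs with the oracle encoding `H`; the answers
to different queries are drawn independently. -/
def Strategy.outputLaw {n : ℕ} (H : Op n) : {T : ℕ} → Strategy n T → PMF (PureState n)
  | _, .output ψ => PMF.pure ψ
  | _, .ask q next => (oracle H q).bind fun y => (next y).outputLaw H

/-- The expectation of `⟨ψ|H|ψ⟩ - λ_min(H)` over the output state `ψ`. -/
def Strategy.expectedError {n T : ℕ} (A : Strategy n T) (H : Op n) : ℝ≥0∞ :=
  ∑' ψ, A.outputLaw H ψ * ENNReal.ofReal ((ψ.sandwich H).re - lambdaMin H)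

/-- The optimization error on a set of observables of a randomized algorithm: a seed `ω` with law
`μ` supplies all the random choices of the algorithm. -/
def optimizationError {n T : ℕ} {Ω : Type*} [MeasurableSpace Ω] (μ : Measure Ω)
    (A : Ω → Strategy n T) (F : Set (Op n)) : ℝ≥0∞ :=
  ⨆ H ∈ F, ∫⁻ ω, (A ω).expectedError H ∂μ

/-! ### The family of objective observables -/

/-- `H_v^δ = -∑ i, (sin(π/4 + v_i δ) X_i + cos(π/4 + v_i δ) Z_i)` for `v ∈ {-1,1}ⁿ`. -/
def objective {n : ℕ} (δ : ℝ) (v : Fin n → ℤˣ) : Op n :=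
  -∑ i, (((Real.sin (Real.pi / 4 + ((v i : ℤ) : ℝ) * δ) : ℝ) : ℂ) •
        (PauliString.single i Pauli.X).op +
      ((Real.cos (Real.pi / 4 + ((v i : ℤ) : ℝ) * δ) : ℝ) : ℂ) •
        (PauliString.single i Pauli.Z).op)

/-- The bias parameter `δ(ε) = √(45 ε / n)`. -/
def bias (n : ℕ) (ε : ℝ) : ℝ := Real.sqrt (45 * ε / n)

/-- The family of the observables `H_v^{δ(ε)}` for all `v ∈ {-1,1}ⁿ`. -/
def family (n : ℕ) (ε : ℝ) : Set (Op n) := Set.range (objective (n := n) (bias n ε))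

end Variational

end

/-!
The proof is Assouad's method, with relative entropy controlled through the Donsker–Varadhan
inequality.

*From optimization to guessing signs.* The smallest eigenvalue of `H_v` is `-n`, attained at a
product state, and the error of a state is a sum over the qubits. On qubit `i` it is `1` minus the
component of the Bloch vector in the direction of angle `π/4 + v_i δ` in the `X`-`Z` plane. If `v_i`
is guessed from the side of the diagonal on which the Bloch vector lies, then every wrong guess
costs at least `1 - cos δ` (`le_sandwich_sub_lambdaMin`).

*What a query reveals.* The expansion of `H_v` contains `X_i` and `Z_i` with weights
`(cos δ ± v_i sin δ) / √2`, whose signs and whose sum `√2 cos δ` do not depend on `v`.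
Whether a term is trivially zero depends only on the qubit of its Pauli factor from `H_v`, so the
normalization factor is the same for all `v` (`normalization_objective`), and `v` enters the answer
only through the choice between `X_i` and `Z_i` for a qubit `i` whose law is free of `v`. The
divergences between the answers for `v` and for `v` with one sign flipped, added up over the `n`
flips, are therefore `O(δ²)` per query (`flipDivergenceLE_oracle`), uniformly over all queries.

*Conclusion.* By the chain rule (`FlipDivergenceLE.bind`) the sum of the divergences after `T`
adaptive queries is `O(T δ²)`. On average over `v`, at least `3n/8 - O(T δ²)` guesses are then wrong
(`FlipDivergenceLE.le_sum_wrong`), while an error of at most `ε` allows only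
`ε / (1 - cos δ) ≤ n / 18` of them. Hence `T ≥ c n / δ² = c' n² / ε`.
-/

noncomputable section

namespace Variational

/-! ### Divergence between the laws at neighbouring sign vectors -/

/-- The sign vector `v` with its coordinate `i` negated. -/
def flipAt {n : ℕ} (v : Fin n → ℤˣ) (i : Fin n) : Fin n → ℤˣ :=
  Function.update v i (-v i)

theorem flipAt_self {n : ℕ} (v : Fin n → ℤˣ) (i : Fin n) : flipAt v i i = -v i := by
  simp [flipAt]

theorem flipAt_of_ne {n : ℕ} (v : Fin n → ℤˣ) {i j : Fin n} (h : j ≠ i) : flipAt v i j = v j := by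
  simp [flipAt, h]

theorem flipAt_flipAt {n : ℕ} (v : Fin n → ℤˣ) (i : Fin n) : flipAt (flipAt v i) i = v := by
  simp [flipAt]

/-- The laws `L v`, indexed by sign vectors, are the images of laws `P v` on one finite set of
outcomes, and bounds `k v i` on the relative entropies of `P v` with respect to `P (flipAt v i)`
add up to at most `B` over the coordinates `i`. That `k v i` is such a bound is encoded by the
Donsker–Varadhan inequality `𝔼_v g - k v i ≤ log 𝔼_{flipAt v i} exp g` for all `g`. -/
def FlipDivergenceLE {n : ℕ} {α : Type*} (L : (Fin n → ℤˣ) → PMF α) (B : ℝ) : Prop :=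
  ∃ (ι : Type) (_ : Fintype ι) (y : ι → α) (P : (Fin n → ℤˣ) → ι → ℝ)
    (k : (Fin n → ℤˣ) → Fin n → ℝ),
    (∀ v a, 0 ≤ P v a) ∧ (∀ v, ∑ a, P v a = 1) ∧
    (∀ v (F : α → ℝ≥0∞), ∑' z, L v z * F z = ∑ a, ENNReal.ofReal (P v a) * F (y a)) ∧
    (∀ v i (g : ι → ℝ),
      Real.exp (∑ a, P v a * g a - k v i) ≤ ∑ a, P (flipAt v i) a * Real.exp (g a)) ∧
    ∀ v, ∑ i, k v i ≤ B

theorem FlipDivergenceLE.mono {n : ℕ} {α : Type*} {L : (Fin n → ℤˣ) → PMF α} {B C : ℝ}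
    (h : FlipDivergenceLE L B) (hBC : B ≤ C) : FlipDivergenceLE L C := by
  obtain ⟨ι, inst, y, P, k, h1, h2, h3, h4, h5⟩ := h
  exact ⟨ι, inst, y, P, k, h1, h2, h3, h4, fun v => (h5 v).trans hBC⟩

theorem FlipDivergenceLE.pure {n : ℕ} {α : Type*} (a : α) :
    FlipDivergenceLE (fun _ : Fin n → ℤˣ => PMF.pure a) 0 := by
  refine ⟨Unit, inferInstance, fun _ => a, fun _ _ => 1, fun _ _ => 0, ?_, ?_, ?_, ?_, ?_⟩
  · simp
  · simp
  · intro v F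
    rw [tsum_eq_single a (fun b hb => by simp [PMF.pure_apply, hb])]
    simp
  · simp
  · simp

theorem tsum_bind_mul {α β : Type*} (p : PMF α) (f : α → PMF β) (F : β → ℝ≥0∞) :
    ∑' z, (p.bind f) z * F z = ∑' a, p a * ∑' z, f a z * F z := by
  simp_rw [PMF.bind_apply, ← ENNReal.tsum_mul_right, ← ENNReal.tsum_mul_left]
  rw [ENNReal.tsum_comm]
  simp_rw [mul_assoc]

/-- The chain rule: in an adaptive experiment the divergences of the stages add up. -/
theorem FlipDivergenceLE.bind {n : ℕ} {α β : Type*} {L : (Fin n → ℤˣ) → PMF α}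
    {M : (Fin n → ℤˣ) → α → PMF β} {B C : ℝ} (hL : FlipDivergenceLE L B)
    (hM : ∀ a, FlipDivergenceLE (fun v => M v a) C) :
    FlipDivergenceLE (fun v => (L v).bind (M v)) (B + C) := by
  obtain ⟨ι, _, y, P, k, hP0, hP1, hPL, hPk, hk⟩ := hL
  choose κ inst z Q l hQ0 hQ1 hQL hQl hl using fun a => hM (y a)
  refine ⟨Σ a, κ a, inferInstance, fun x => z x.1 x.2, fun v x => P v x.1 * Q x.1 v x.2,
    fun v i => k v i + ∑ a, P v a * l a v i, ?_, ?_, ?_, ?_, ?_⟩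
  · exact fun v x => mul_nonneg (hP0 _ _) (hQ0 _ _ _)
  · intro v
    simp_rw [Fintype.sum_sigma, ← Finset.mul_sum, hQ1, mul_one, hP1]
  · intro v F
    rw [tsum_bind_mul, hPL, Fintype.sum_sigma]
    refine Finset.sum_congr rfl fun a _ => ?_
    rw [hQL, Finset.mul_sum]
    refine Finset.sum_congr rfl fun b _ => ?_
    rw [ENNReal.ofReal_mul (hP0 _ _), mul_assoc]
  · intro v i g
    rw [Fintype.sum_sigma, Fintype.sum_sigma]
    have h := hPk v i fun a => ∑ b, Q a v b * g ⟨a, b⟩ - l a v i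
    have e : ∑ a, ∑ b, P v a * Q a v b * g ⟨a, b⟩ - (k v i + ∑ a, P v a * l a v i)
        = ∑ a, P v a * (∑ b, Q a v b * g ⟨a, b⟩ - l a v i) - k v i := by
      simp_rw [mul_sub, Finset.sum_sub_distrib, Finset.mul_sum, mul_assoc]
      ring
    rw [e]
    refine h.trans (Finset.sum_le_sum fun a _ => ?_)
    simp_rw [mul_assoc, ← Finset.mul_sum]
    exact mul_le_mul_of_nonneg_left (hQl a v i _) (hP0 _ _)
  · intro v
    rw [Finset.sum_add_distrib, Finset.sum_comm]
    simp_rw [← Finset.mul_sum]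
    have : ∑ a, P v a * ∑ i, l a v i ≤ ∑ a, P v a * C :=
      Finset.sum_le_sum fun a _ => mul_le_mul_of_nonneg_left (hl a v) (hP0 _ _)
    rw [← Finset.sum_mul, hP1, one_mul] at this
    linarith [hk v]

/-- The Donsker–Varadhan inequality with the `χ²`-divergence in place of relative entropy. -/
theorem exp_sum_sub_chiSq_le {α : Type*} [Fintype α] {p q : α → ℝ} (hp : ∀ a, 0 ≤ p a)
    (hq : ∀ a, 0 ≤ q a) (hp1 : ∑ a, p a = 1) (hq1 : ∑ a, q a = 1)
    (hpq : ∀ a, q a = 0 → p a = 0) (g : α → ℝ) :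
    Real.exp (∑ a, p a * g a - ∑ a, (p a - q a) ^ 2 / q a) ≤ ∑ a, q a * Real.exp (g a) := by
  set M := ∑ a, p a * g a - ∑ a, (p a - q a) ^ 2 / q a with hM
  -- With `r = p / q` this is `exp y ≥ r * (1 + y - log r) ≥ r * (1 + y - (r - 1))`.
  have key : ∀ a, p a * (1 + (g a - M)) - (p a - q a) ^ 2 / q a - (p a - q a)
      ≤ q a * Real.exp (g a - M) := by
    intro a
    rcases (hq a).eq_or_lt with h0 | hqa
    · simp [← h0, hpq a h0.symm]
    rcases (hp a).eq_or_lt with h0 | hpa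
    · rw [← h0]
      have : (0 - q a) ^ 2 / q a = q a := by field_simp; ring
      rw [this]
      have := mul_pos hqa (Real.exp_pos (g a - M))
      linarith
    · have hr : 0 < p a / q a := div_pos hpa hqa
      have h1 := Real.add_one_le_exp (g a - M - Real.log (p a / q a))
      rw [Real.exp_sub, Real.exp_log hr, le_div_iff₀ hr] at h1
      have h2 := Real.log_le_sub_one_of_pos hr
      have h3 : (1 + (g a - M) - (p a / q a - 1)) * (p a / q a) ≤ Real.exp (g a - M) :=
        (mul_le_mul_of_nonneg_right (by linarith) hr.le).trans h1
      have h4 := mul_le_mul_of_nonneg_left h3 hqa.le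
      refine le_of_eq_of_le ?_ h4
      field_simp
      ring
  have hsum := Finset.sum_le_sum fun a (_ : a ∈ Finset.univ) => key a
  have e : ∑ a, (p a * (1 + (g a - M)) - (p a - q a) ^ 2 / q a - (p a - q a)) = 1 := by
    simp_rw [Finset.sum_sub_distrib, mul_add, mul_sub, Finset.sum_add_distrib,
      Finset.sum_sub_distrib, mul_one, ← Finset.sum_mul, hp1, hq1, one_mul, hM]
    ring
  rw [e] at hsum
  simp_rw [Real.exp_sub, mul_div_assoc', ← Finset.sum_div] at hsum
  rwa [le_div_iff₀ (Real.exp_pos _), one_mul] at hsum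

theorem FlipDivergenceLE.of_chiSq {n : ℕ} {α : Type} [Fintype α] (L : (Fin n → ℤˣ) → PMF α)
    {B : ℝ} (hac : ∀ v i a, L (flipAt v i) a = 0 → L v a = 0)
    (hB : ∀ v, ∑ i, ∑ a,
      ((L v a).toReal - (L (flipAt v i) a).toReal) ^ 2 / (L (flipAt v i) a).toReal ≤ B) :
    FlipDivergenceLE L B := by
  have hsum : ∀ v, ∑ a, (L v a).toReal = 1 := fun v => by
    rw [← ENNReal.toReal_sum fun a _ => (L v).apply_ne_top a,
      ← tsum_fintype (L := .unconditional α), (L v).tsum_coe, ENNReal.toReal_one]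
  refine ⟨α, inferInstance, id, fun v a => (L v a).toReal, _, fun _ _ => ENNReal.toReal_nonneg,
    hsum, ?_, fun v i g => exp_sum_sub_chiSq_le (fun _ => ENNReal.toReal_nonneg)
      (fun _ => ENNReal.toReal_nonneg) (hsum _) (hsum _) ?_ g, hB⟩
  · intro v F
    rw [tsum_fintype]
    refine Finset.sum_congr rfl fun a _ => ?_
    rw [ENNReal.ofReal_toReal ((L v).apply_ne_top a), id]
  · intro a ha
    rw [ENNReal.toReal_eq_zero_iff] at ha
    rw [hac v i a (ha.resolve_right ((L _).apply_ne_top a)), ENNReal.toReal_zero]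

theorem FlipDivergenceLE.const {n : ℕ} {α : Type} [Fintype α] (p : PMF α) :
    FlipDivergenceLE (fun _ : Fin n → ℤˣ => p) 0 :=
  .of_chiSq _ (fun _ _ _ h => h) fun _ => by simp

/-! ### Tensor products of single-qubit operators -/

/-- The tensor product `m 0 ⊗ ⋯ ⊗ m (n - 1)` of single-qubit operators. -/
def tens {n : ℕ} (m : Fin n → Matrix (Fin 2) (Fin 2) ℂ) : Op n :=
  Matrix.of fun x y => ∏ i, m i (x i) (y i)

theorem pauliString_op_eq_tens {n : ℕ} (s : PauliString n) : s.op = tens fun i => (s i).mat := rfl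

theorem sum_prod_apply {n : ℕ} (f : Fin n → Fin 2 → ℂ) :
    ∑ x : Fin n → Fin 2, ∏ i, f i (x i) = ∏ i, ∑ b, f i b := by
  have h := Finset.prod_univ_sum (fun _ : Fin n => (Finset.univ : Finset (Fin 2))) f
  rw [Fintype.piFinset_univ] at h
  exact h.symm

theorem tens_mul {n : ℕ} (m m' : Fin n → Matrix (Fin 2) (Fin 2) ℂ) :
    tens m * tens m' = tens fun i => m i * m' i := by
  ext x y
  simp only [tens, Matrix.mul_apply, Matrix.of_apply, ← Finset.prod_mul_distrib]
  exact sum_prod_apply fun i b => m i (x i) b * m' i b (y i)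

theorem trace_tens {n : ℕ} (m : Fin n → Matrix (Fin 2) (Fin 2) ℂ) :
    (tens m).trace = ∏ i, (m i).trace := by
  simp only [Matrix.trace, Matrix.diag, tens, Matrix.of_apply]
  exact sum_prod_apply fun i b => m i b b

theorem tens_mulVec {n : ℕ} (m : Fin n → Matrix (Fin 2) (Fin 2) ℂ) (φ : Fin n → Fin 2 → ℂ) :
    tens m *ᵥ (fun x => ∏ i, φ i (x i)) = fun x => ∏ i, (m i *ᵥ φ i) (x i) := by
  ext x
  simp only [tens, Matrix.mulVec, dotProduct, Matrix.of_apply, ← Finset.prod_mul_distrib]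
  exact sum_prod_apply fun i b => m i (x i) b * φ i b

theorem tens_one {n : ℕ} : tens (fun _ : Fin n => 1) = 1 := by
  have h := Query.pauliString_mul_self (fun _ : Fin n => Pauli.I)
  rw [pauliString_op_eq_tens, tens_mul] at h
  simpa [Pauli.mat] using h

theorem tens_conjTranspose {n : ℕ} (m : Fin n → Matrix (Fin 2) (Fin 2) ℂ) :
    (tens m)ᴴ = tens fun i => (m i)ᴴ := by
  ext x y
  simp [tens, Matrix.conjTranspose_apply, star_prod]

/-- The operator `M` on qubit `i`, tensored with the identity on all other qubits. -/
def localOp {n : ℕ} (i : Fin n) (M : Matrix (Fin 2) (Fin 2) ℂ) : Op n :=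
  tens (Function.update (fun _ => 1) i M)

theorem single_op {n : ℕ} (i : Fin n) (a : Pauli) :
    (PauliString.single i a).op = localOp i a.mat := by
  rw [pauliString_op_eq_tens, localOp]
  congr 1
  ext1 j
  by_cases h : j = i
  · subst h; simp [PauliString.single]
  · simp [PauliString.single, h, Pauli.mat]

theorem localOp_apply {n : ℕ} (i : Fin n) (M : Matrix (Fin 2) (Fin 2) ℂ) (x y : Fin n → Fin 2) :
    localOp i M x y = M (x i) (y i) *
      ∏ j ∈ Finset.univ.erase i, (1 : Matrix (Fin 2) (Fin 2) ℂ) (x j) (y j) := by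
  simp only [localOp, tens, Matrix.of_apply]
  rw [← Finset.mul_prod_erase _ _ (Finset.mem_univ i)]
  congr 1
  · simp
  · exact Finset.prod_congr rfl fun j hj => by simp [Finset.ne_of_mem_erase hj]

theorem localOp_add {n : ℕ} (i : Fin n) (M N : Matrix (Fin 2) (Fin 2) ℂ) :
    localOp i (M + N) = localOp i M + localOp i N := by
  ext x y
  simp [localOp_apply, add_mul]

theorem localOp_smul {n : ℕ} (i : Fin n) (c : ℂ) (M : Matrix (Fin 2) (Fin 2) ℂ) :
    localOp i (c • M) = c • localOp i M := by
  ext x y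
  simp [localOp_apply, mul_assoc]

/-! ### The energy of a state -/

/-- The single-qubit observable `sin θ X + cos θ Z`. -/
def rot (θ : ℝ) : Matrix (Fin 2) (Fin 2) ℂ :=
  ((Real.sin θ : ℝ) : ℂ) • Pauli.X.mat + ((Real.cos θ : ℝ) : ℂ) • Pauli.Z.mat

/-- The angle `π/4 + v_i δ` of the observable on qubit `i`. -/
def angle {n : ℕ} (δ : ℝ) (v : Fin n → ℤˣ) (i : Fin n) : ℝ :=
  Real.pi / 4 + ((v i : ℤ) : ℝ) * δ

theorem objective_eq {n : ℕ} (δ : ℝ) (v : Fin n → ℤˣ) :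
    objective δ v = -∑ i, localOp i (rot (angle δ v i)) := by
  simp only [objective, rot, localOp_add, localOp_smul, single_op, angle]

theorem rot_mul_conjTranspose (θ : ℝ) : rot θ * (rot θ)ᴴ = 1 := by
  have h : ((Real.sin θ : ℝ) : ℂ) * (Real.sin θ : ℝ) + ((Real.cos θ : ℝ) : ℂ) * (Real.cos θ : ℝ)
      = 1 := by
    rw [← Complex.ofReal_mul, ← Complex.ofReal_mul, ← Complex.ofReal_add, ← sq, ← sq,
      Real.sin_sq_add_cos_sq, Complex.ofReal_one]
  unfold rot
  generalize Real.sin θ = a at h ⊢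
  generalize Real.cos θ = b at h ⊢
  ext i j
  fin_cases i <;> fin_cases j <;>
    simp only [ Pauli.mat, Matrix.mul_apply, Fin.sum_univ_two, Matrix.conjTranspose_apply,
      Matrix.add_apply, Matrix.smul_apply] <;> simp <;>
    first | linear_combination h | ring

theorem localOp_rot_mem {n : ℕ} (i : Fin n) (θ : ℝ) :
    localOp i (rot θ) ∈ Matrix.unitaryGroup (Fin n → Fin 2) ℂ := by
  rw [Matrix.mem_unitaryGroup_iff, Matrix.star_eq_conjTranspose, localOp, tens_conjTranspose,
    tens_mul, ← tens_one]
  congr 1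
  ext1 j
  by_cases h : j = i
  · subst h; simp [rot_mul_conjTranspose]
  · simp [h]

/-- `⟨ψ|a_i|ψ⟩` for a Pauli operator `a` on qubit `i`. -/
def mean {n : ℕ} (ψ : PureState n) (i : Fin n) (a : Pauli) : ℝ :=
  (ψ.sandwich (localOp i a.mat)).re

theorem sandwich_add {n : ℕ} (ψ : PureState n) (M N : Op n) :
    ψ.sandwich (M + N) = ψ.sandwich M + ψ.sandwich N := by
  simp [PureState.sandwich, Matrix.add_mulVec, dotProduct_add]

theorem sandwich_smul {n : ℕ} (ψ : PureState n) (c : ℂ) (M : Op n) :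
    ψ.sandwich (c • M) = c * ψ.sandwich M := by
  simp [PureState.sandwich, Matrix.smul_mulVec, dotProduct_smul]

theorem sandwich_neg {n : ℕ} (ψ : PureState n) (M : Op n) :
    ψ.sandwich (-M) = -ψ.sandwich M := by
  simp [PureState.sandwich, Matrix.neg_mulVec]

theorem sandwich_sum {n : ℕ} {ι : Type*} (ψ : PureState n) (s : Finset ι) (M : ι → Op n) :
    ψ.sandwich (∑ i ∈ s, M i) = ∑ i ∈ s, ψ.sandwich (M i) := by
  simp [PureState.sandwich, Matrix.sum_mulVec, dotProduct_sum]

theorem sandwich_localOp_rot_re {n : ℕ} (ψ : PureState n) (i : Fin n) (θ : ℝ) :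
    (ψ.sandwich (localOp i (rot θ))).re
      = Real.sin θ * mean ψ i .X + Real.cos θ * mean ψ i .Z := by
  simp only [rot, localOp_add, localOp_smul, sandwich_add, sandwich_smul, Complex.add_re,
    Complex.re_ofReal_mul, mean]

/-- The `X` and `Z` components of a Bloch vector lie in the unit disk. -/
theorem sin_mul_mean_add_cos_mul_mean_le_one {n : ℕ} (ψ : PureState n) (i : Fin n) (θ : ℝ) :
    Real.sin θ * mean ψ i .X + Real.cos θ * mean ψ i .Z ≤ 1 := by
  rw [← sandwich_localOp_rot_re]
  exact (le_abs_self _).trans ((Complex.abs_re_le_norm _).trans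
    (Query.norm_sandwich_le ψ _ (localOp_rot_mem i θ)))

theorem sandwich_objective_re {n : ℕ} (ψ : PureState n) (δ : ℝ) (v : Fin n → ℤˣ) :
    (ψ.sandwich (objective δ v)).re
      = -∑ i, (Real.sin (angle δ v i) * mean ψ i .X + Real.cos (angle δ v i) * mean ψ i .Z) := by
  simp only [objective_eq, sandwich_neg, sandwich_sum, Complex.neg_re, Complex.re_sum,
    sandwich_localOp_rot_re]

/-- The `+1` eigenvector of `rot θ`. -/
def rotVec (θ : ℝ) : Fin 2 → ℂ := ![(Real.cos (θ / 2) : ℝ), (Real.sin (θ / 2) : ℝ)]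

theorem rot_mulVec_rotVec (θ : ℝ) : rot θ *ᵥ rotVec θ = rotVec θ := by
  have h1 : Real.sin θ * Real.sin (θ / 2) + Real.cos θ * Real.cos (θ / 2) = Real.cos (θ / 2) := by
    have := Real.cos_sub θ (θ / 2)
    rw [sub_half] at this
    linarith
  have h2 : Real.sin θ * Real.cos (θ / 2) - Real.cos θ * Real.sin (θ / 2) = Real.sin (θ / 2) := by
    have := Real.sin_sub θ (θ / 2)
    rw [sub_half] at this
    linarith
  have e : rotVec θ = ![((Real.sin θ * Real.sin (θ / 2) + Real.cos θ * Real.cos (θ / 2) : ℝ) : ℂ),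
      ((Real.sin θ * Real.cos (θ / 2) - Real.cos θ * Real.sin (θ / 2) : ℝ) : ℂ)] := by
    rw [h1, h2]; rfl
  conv_rhs => rw [e]
  rw [rot, rotVec]
  generalize Real.sin θ = a
  generalize Real.cos θ = b
  ext i
  fin_cases i
  · simp [Pauli.mat, Matrix.mulVec, dotProduct, Fin.sum_univ_two]
    ring
  · simp [Pauli.mat, Matrix.mulVec, dotProduct, Fin.sum_univ_two]
    ring

theorem rotVec_ne_zero (θ : ℝ) : ∃ b, rotVec θ b ≠ 0 := by
  by_contra! h
  have h0 : Real.cos (θ / 2) = 0 := Complex.ofReal_injective (h 0)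
  have h1 : Real.sin (θ / 2) = 0 := Complex.ofReal_injective (h 1)
  have := Real.sin_sq_add_cos_sq (θ / 2)
  rw [h0, h1] at this
  norm_num at this

/-- The product of the single-qubit ground states has energy `-n`. -/
theorem lambdaMin_objective_le {n : ℕ} (δ : ℝ) (v : Fin n → ℤˣ) :
    lambdaMin (objective δ v) ≤ -n := by
  refine csInf_le (Matrix.finite_real_spectrum (A := objective δ v)).bddBelow ?_
  set Φ : (Fin n → Fin 2) → ℂ := fun x => ∏ i, rotVec (angle δ v i) (x i) with hΦ
  have hloc : ∀ i, localOp i (rot (angle δ v i)) *ᵥ Φ = Φ := by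
    intro i
    rw [localOp, hΦ, tens_mulVec]
    ext x
    refine Finset.prod_congr rfl fun j _ => ?_
    by_cases h : j = i
    · subst h; rw [Function.update_self, rot_mulVec_rotVec]
    · simp [h]
  have hH : objective δ v *ᵥ Φ = -(n : ℂ) • Φ := by
    rw [objective_eq, Matrix.neg_mulVec, Matrix.sum_mulVec, Finset.sum_congr rfl fun i _ => hloc i]
    simp [← Nat.cast_smul_eq_nsmul ℂ]
  choose x hx using fun i => rotVec_ne_zero (angle δ v i)
  have hΦ0 : Φ ≠ 0 := fun h => by
    have := congrFun h x
    simp only [hΦ, Pi.zero_apply] at this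
    exact Finset.prod_ne_zero_iff.mpr (fun i _ => hx i) this
  rw [spectrum.mem_iff]
  intro hu
  obtain ⟨B, hB⟩ := hu.exists_left_inv
  apply hΦ0
  have hz : (algebraMap ℝ (Op n) (-n) - objective δ v) *ᵥ Φ = 0 := by
    rw [Matrix.sub_mulVec, hH, Algebra.algebraMap_eq_smul_one, Matrix.smul_mulVec,
      Matrix.one_mulVec]
    ext x
    simp
  rw [← Matrix.one_mulVec Φ, ← hB, ← Matrix.mulVec_mulVec, hz, Matrix.mulVec_zero]

/-! ### Reading off the sign vector from a state -/

theorem sin_pi_div_four_add (u : ℤˣ) (δ : ℝ) : Real.sin (Real.pi / 4 + ((u : ℤ) : ℝ) * δ)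
    = (Real.cos δ + ((u : ℤ) : ℝ) * Real.sin δ) / √2 := by
  have h : √2 / 2 = 1 / √2 := by
    rw [div_eq_div_iff (by norm_num) (by positivity)]; simp
  rcases Int.units_eq_one_or u with rfl | rfl <;>
    simp [Real.sin_add, Real.sin_pi_div_four, Real.cos_pi_div_four, h] <;> field_simp

theorem cos_pi_div_four_add (u : ℤˣ) (δ : ℝ) : Real.cos (Real.pi / 4 + ((u : ℤ) : ℝ) * δ)
    = (Real.cos δ - ((u : ℤ) : ℝ) * Real.sin δ) / √2 := by
  have h : √2 / 2 = 1 / √2 := by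
    rw [div_eq_div_iff (by norm_num) (by positivity)]; simp
  rcases Int.units_eq_one_or u with rfl | rfl <;>
    simp [Real.cos_add, Real.sin_pi_div_four, Real.cos_pi_div_four, h] <;> field_simp

open Classical in
/-- The sign of `v i` guessed from `ψ`: on which side of the diagonal `x = z` the Bloch vector of
qubit `i` lies. -/
def guess {n : ℕ} (ψ : PureState n) (i : Fin n) : ℤˣ :=
  if mean ψ i .Z ≤ mean ψ i .X then 1 else -1

/-- The indicator function of a correct guess of `v i`. -/
def correct {n : ℕ} (v : Fin n → ℤˣ) (i : Fin n) (ψ : PureState n) : ℝ :=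
  if guess ψ i = v i then 1 else 0

/-- On a qubit with a wrong guess the Bloch vector makes an angle of at least `δ` with the optimal
direction, and so loses at least `1 - cos δ`. -/
theorem le_one_sub_energy {n : ℕ} (ψ : PureState n) {δ : ℝ} (hs : 0 ≤ Real.sin δ)
    (hc : 0 ≤ Real.cos δ) (v : Fin n → ℤˣ) (i : Fin n) :
    (1 - Real.cos δ) * (1 - correct v i ψ)
      ≤ 1 - (Real.sin (angle δ v i) * mean ψ i .X + Real.cos (angle δ v i) * mean ψ i .Z) := by
  by_cases h : guess ψ i = v i
  · simpa [correct, h] using sin_mul_mean_add_cos_mul_mean_le_one ψ i (angle δ v i)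
  have h1 := sin_mul_mean_add_cos_mul_mean_le_one ψ i (Real.pi / 4)
  rw [Real.sin_pi_div_four, Real.cos_pi_div_four] at h1
  have h2 : √2 / 2 = 1 / √2 := by
    rw [div_eq_div_iff (by norm_num) (by positivity)]; simp
  rw [h2] at h1
  have h3 : ((v i : ℤ) : ℝ) * (mean ψ i .X - mean ψ i .Z) ≤ 0 := by
    unfold guess at h
    split_ifs at h with hg <;> rcases Int.units_eq_one_or (v i) with hv | hv <;>
      simp [hv] at h ⊢ <;> linarith
  have e : Real.sin (angle δ v i) * mean ψ i .X + Real.cos (angle δ v i) * mean ψ i .Z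
      = Real.cos δ * (1 / √2 * mean ψ i .X + 1 / √2 * mean ψ i .Z)
        + Real.sin δ / √2 * (((v i : ℤ) : ℝ) * (mean ψ i .X - mean ψ i .Z)) := by
    rw [angle, sin_pi_div_four_add, cos_pi_div_four_add]
    ring
  rw [e]
  simp only [correct, h, if_false]
  have h4 := mul_le_mul_of_nonneg_left h1 hc
  have h5 := mul_nonpos_of_nonneg_of_nonpos
    (div_nonneg hs (Real.sqrt_nonneg 2)) h3
  linarith

theorem le_sandwich_sub_lambdaMin {n : ℕ} (ψ : PureState n) {δ : ℝ} (hs : 0 ≤ Real.sin δ)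
    (hc : 0 ≤ Real.cos δ) (v : Fin n → ℤˣ) :
    (1 - Real.cos δ) * ∑ i, (1 - correct v i ψ)
      ≤ (ψ.sandwich (objective δ v)).re - lambdaMin (objective δ v) := by
  have h1 := lambdaMin_objective_le δ v
  have h2 := Finset.sum_le_sum fun i (_ : i ∈ Finset.univ) => le_one_sub_energy ψ hs hc v i
  rw [← Finset.mul_sum, Finset.sum_sub_distrib (fun _ => (1 : ℝ)) fun i => Real.sin _ * _ + _] at h2
  simp only [Finset.sum_const, Finset.card_univ, Fintype.card_fin, nsmul_eq_mul, mul_one] at h2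
  rw [sandwich_objective_re]
  linarith

/-! ### Pauli coefficients of the objective observables -/

theorem trace_pauli_mul (a b : Pauli) : (a.mat * b.mat).trace = if a = b then 2 else 0 := by
  cases a <;> cases b <;>
    simp [Pauli.mat, Matrix.trace, Fin.sum_univ_two] <;> norm_num

theorem trace_pauliString_mul {n : ℕ} (s t : PauliString n) :
    (s.op * t.op).trace = if s = t then 2 ^ n else 0 := by
  rw [pauliString_op_eq_tens, pauliString_op_eq_tens, tens_mul, trace_tens]
  simp_rw [trace_pauli_mul]
  by_cases h : s = t
  · simp [h]
  · obtain ⟨i, hi⟩ := Function.ne_iff.mp h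
    rw [if_neg h]
    exact Finset.prod_eq_zero (Finset.mem_univ i) (if_neg hi)

theorem single_inj {n : ℕ} {i j : Fin n} {a b : Pauli} (ha : a ≠ .I) :
    PauliString.single i a = PauliString.single j b ↔ i = j ∧ a = b := by
  refine ⟨fun h => ?_, fun h => by rw [h.1, h.2]⟩
  have hi := congrFun h i
  by_cases hij : i = j
  · subst hij
    exact ⟨rfl, by simpa [PauliString.single] using hi⟩
  · simp [PauliString.single, hij] at hi
    exact absurd hi ha

theorem qubits_single {n : ℕ} (i : Fin n) {a : Pauli} (ha : a ≠ .I) :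
    (PauliString.single i a).qubits = {i} := by
  ext j
  rw [PauliString.qubits, Finset.mem_filter, Finset.mem_singleton]
  by_cases h : j = i
  · subst h; simp [PauliString.single, ha]
  · simp [PauliString.single, h]

/-- The coefficient of the Pauli product `s` in `-objective δ v`. It is nonnegative as long as
`0 ≤ sin δ < cos δ`, and then equals the absolute value of the coefficient in `objective δ v`. -/
def amplitude {n : ℕ} (δ : ℝ) (v : Fin n → ℤˣ) (s : PauliString n) : ℝ :=
  ∑ i, ((if s = PauliString.single i .X then Real.sin (angle δ v i) else 0)
    + if s = PauliString.single i .Z then Real.cos (angle δ v i) else 0)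

theorem pauliCoeff_objective {n : ℕ} (δ : ℝ) (v : Fin n → ℤˣ) (s : PauliString n) :
    pauliCoeff (objective δ v) s = -amplitude δ v s := by
  have h : (s.op * objective δ v).trace = ((-amplitude δ v s * 2 ^ n : ℝ) : ℂ) := by
    simp only [objective, mul_neg, Matrix.mul_sum, mul_add, Matrix.mul_smul,
      Matrix.trace_neg, Matrix.trace_sum, Matrix.trace_add, Matrix.trace_smul,
      trace_pauliString_mul, amplitude, neg_mul, Finset.sum_mul, add_mul, ite_mul, zero_mul]
    push_cast
    congr 1
    refine Finset.sum_congr rfl fun i _ => ?_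
    congr 1 <;> split_ifs <;> simp [angle]
  rw [pauliCoeff, h, Complex.ofReal_re]
  field_simp

theorem amplitude_single_X {n : ℕ} (δ : ℝ) (v : Fin n → ℤˣ) (i : Fin n) :
    amplitude δ v (PauliString.single i .X) = Real.sin (angle δ v i) := by
  simp [amplitude, single_inj]

theorem amplitude_single_Z {n : ℕ} (δ : ℝ) (v : Fin n → ℤˣ) (i : Fin n) :
    amplitude δ v (PauliString.single i .Z) = Real.cos (angle δ v i) := by
  simp [amplitude, single_inj]

theorem amplitude_eq_zero {n : ℕ} (δ : ℝ) (v : Fin n → ℤˣ) {s : PauliString n}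
    (h : ∀ i, s ≠ PauliString.single i .X ∧ s ≠ PauliString.single i .Z) :
    amplitude δ v s = 0 := by
  simp [amplitude, h]

theorem angle_flipAt_self {n : ℕ} (δ : ℝ) (v : Fin n → ℤˣ) (i : Fin n) :
    angle δ (flipAt v i) i = Real.pi / 4 + (((-v i : ℤˣ) : ℤ) : ℝ) * δ := by
  rw [angle, flipAt_self]

theorem angle_flipAt_of_ne {n : ℕ} (δ : ℝ) (v : Fin n → ℤˣ) {i j : Fin n} (h : j ≠ i) :
    angle δ (flipAt v i) j = angle δ v j := by
  rw [angle, flipAt_of_ne v h, angle]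

theorem sin_angle_pos {n : ℕ} {δ : ℝ} (hs : 0 ≤ Real.sin δ) (hsc : Real.sin δ < Real.cos δ)
    (v : Fin n → ℤˣ) (i : Fin n) : 0 < Real.sin (angle δ v i) := by
  rw [angle, sin_pi_div_four_add]
  refine div_pos ?_ (by positivity)
  rcases Int.units_eq_one_or (v i) with h | h <;> simp [h] <;> linarith

theorem cos_angle_pos {n : ℕ} {δ : ℝ} (hs : 0 ≤ Real.sin δ) (hsc : Real.sin δ < Real.cos δ)
    (v : Fin n → ℤˣ) (i : Fin n) : 0 < Real.cos (angle δ v i) := by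
  rw [angle, cos_pi_div_four_add]
  refine div_pos ?_ (by positivity)
  rcases Int.units_eq_one_or (v i) with h | h <;> simp [h] <;> linarith

theorem amplitude_nonneg {n : ℕ} {δ : ℝ} (hs : 0 ≤ Real.sin δ) (hsc : Real.sin δ < Real.cos δ)
    (v : Fin n → ℤˣ) (s : PauliString n) : 0 ≤ amplitude δ v s := by
  refine Finset.sum_nonneg fun i _ => add_nonneg ?_ ?_
  · split_ifs
    exacts [(sin_angle_pos hs hsc v i).le, le_rfl]
  · split_ifs
    exacts [(cos_angle_pos hs hsc v i).le, le_rfl]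

theorem amplitude_eq_zero_iff {n : ℕ} {δ : ℝ} (hs : 0 ≤ Real.sin δ)
    (hsc : Real.sin δ < Real.cos δ) (v : Fin n → ℤˣ) (s : PauliString n) :
    amplitude δ v s = 0 ↔ ∀ i, s ≠ PauliString.single i .X ∧ s ≠ PauliString.single i .Z := by
  refine ⟨fun h i => ⟨?_, ?_⟩, amplitude_eq_zero δ v⟩
  · rintro rfl
    rw [amplitude_single_X] at h
    exact (sin_angle_pos hs hsc v i).ne' h
  · rintro rfl
    rw [amplitude_single_Z] at h
    exact (cos_angle_pos hs hsc v i).ne' h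

/-- A Pauli product in the expansion carries information about one coordinate of `v` only: its
coefficient changes only if the sign of its own qubit is flipped, from `(cos δ ± sin δ) / √2` to
`(cos δ ∓ sin δ) / √2`. -/
theorem sum_sq_amplitude_sub_div_le {n : ℕ} {δ : ℝ} (hs : 0 ≤ Real.sin δ)
    (hsc : Real.sin δ < Real.cos δ) (v : Fin n → ℤˣ) (s : PauliString n) :
    ∑ i, (amplitude δ v s - amplitude δ (flipAt v i) s) ^ 2 / amplitude δ (flipAt v i) s
      ≤ 4 * Real.sin δ ^ 2 / (Real.cos δ ^ 2 - Real.sin δ ^ 2) * amplitude δ v s := by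
  have h2 : √2 ^ 2 = 2 := Real.sq_sqrt zero_le_two
  have hd : 0 < Real.cos δ - Real.sin δ := by linarith
  have hd' : 0 < Real.cos δ + Real.sin δ := by linarith
  have hD : Real.cos δ ^ 2 - Real.sin δ ^ 2
      = (Real.cos δ - Real.sin δ) * (Real.cos δ + Real.sin δ) := by ring
  have key1 : ((Real.cos δ + Real.sin δ) / √2 - (Real.cos δ - Real.sin δ) / √2) ^ 2
      / ((Real.cos δ - Real.sin δ) / √2) = 4 * Real.sin δ ^ 2 /
        (Real.cos δ ^ 2 - Real.sin δ ^ 2) * ((Real.cos δ + Real.sin δ) / √2) := by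
    rw [hD]
    field_simp
    ring
  have key2 : ((Real.cos δ - Real.sin δ) / √2 - (Real.cos δ + Real.sin δ) / √2) ^ 2
      / ((Real.cos δ + Real.sin δ) / √2) = 4 * Real.sin δ ^ 2 /
        (Real.cos δ ^ 2 - Real.sin δ ^ 2) * ((Real.cos δ - Real.sin δ) / √2) := by
    rw [hD]
    field_simp
    ring
  by_cases h : ∀ i, s ≠ PauliString.single i .X ∧ s ≠ PauliString.single i .Z
  · simp [amplitude_eq_zero _ _ h]
  push Not at h
  obtain ⟨i, hi⟩ := h
  by_cases hX : s = PauliString.single i .X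
  · subst hX
    simp_rw [amplitude_single_X]
    rw [Finset.sum_eq_single i (fun j _ hj => by simp [angle_flipAt_of_ne _ _ hj.symm]) (by simp),
      angle_flipAt_self, angle, sin_pi_div_four_add, sin_pi_div_four_add]
    rcases Int.units_eq_one_or (v i) with hv | hv <;> rw [hv]
    · simpa [← sub_eq_add_neg] using key1.le
    · simpa [← sub_eq_add_neg] using key2.le
  · obtain rfl := hi hX
    simp_rw [amplitude_single_Z]
    rw [Finset.sum_eq_single i (fun j _ hj => by simp [angle_flipAt_of_ne _ _ hj.symm]) (by simp),
      angle_flipAt_self, angle, cos_pi_div_four_add, cos_pi_div_four_add]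
    rcases Int.units_eq_one_or (v i) with hv | hv <;> rw [hv]
    · simpa [← sub_eq_add_neg] using key2.le
    · simpa [← sub_eq_add_neg] using key1.le

/-! ### What one query reveals -/

/-- The signs of the Pauli coefficients do not depend on `v`. -/
theorem signedPauli_objective {n : ℕ} {δ : ℝ} (hs : 0 ≤ Real.sin δ)
    (hsc : Real.sin δ < Real.cos δ) (v w : Fin n → ℤˣ) (s : PauliString n) :
    signedPauli (objective δ v) s = signedPauli (objective δ w) s := by
  have h : 0 ≤ pauliCoeff (objective δ v) s ↔ 0 ≤ pauliCoeff (objective δ w) s := by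
    have key : ∀ u : Fin n → ℤˣ, 0 ≤ pauliCoeff (objective δ u) s ↔ amplitude δ u s = 0 := by
      intro u
      rw [pauliCoeff_objective, neg_nonneg]
      exact ⟨fun h => le_antisymm h (amplitude_nonneg hs hsc u s), fun h => h.le⟩
    rw [key, key, amplitude_eq_zero_iff hs hsc, amplitude_eq_zero_iff hs hsc]
  simp only [signedPauli, h]

theorem hadamardLaw_objective {n : ℕ} {δ : ℝ} (hs : 0 ≤ Real.sin δ)
    (hsc : Real.sin δ < Real.cos δ) (q : Query n) (v w : Fin n → ℤˣ) (t : q.Term)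
    (R : Finset (Fin q.order)) :
    q.hadamardLaw (objective δ v) t R = q.hadamardLaw (objective δ w) t R := by
  have h : q.hadamardMean (objective δ v) t R = q.hadamardMean (objective δ w) t R := by
    simp only [Query.hadamardMean, Query.product, signedPauli_objective hs hsc v w]
  ext b
  simp only [Query.hadamardLaw, h]

open Classical in
/-- The part of the coefficient of a term that comes from the generators, set to zero if the term
is trivially zero. -/
def genWeight {n : ℕ} (q : Query n) (t : q.Term) : ℝ :=
  if q.Survives t then ∏ s, |pauliCoeff (q.par.gen (q.coord s)) (t.1 s)| else 0

theorem genWeight_nonneg {n : ℕ} (q : Query n) (t : q.Term) : 0 ≤ genWeight q t := by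
  unfold genWeight
  split_ifs
  · positivity
  · exact le_rfl

theorem weight_objective {n : ℕ} {δ : ℝ} (hs : 0 ≤ Real.sin δ) (hsc : Real.sin δ < Real.cos δ)
    (q : Query n) (v : Fin n → ℤˣ) (t : q.Term) :
    q.weight (objective δ v) t = genWeight q t * amplitude δ v t.2 := by
  rw [Query.weight, genWeight, pauliCoeff_objective, abs_neg,
    abs_of_nonneg (amplitude_nonneg hs hsc v t.2), ite_mul, zero_mul]

theorem genWeight_congr {n : ℕ} (q : Query n) (k : Fin q.order → PauliString n)
    {l l' : PauliString n} (h : l.qubits = l'.qubits) :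
    genWeight q (k, l) = genWeight q (k, l') := by
  simp only [genWeight, Query.Survives, h]

/-- Whether a term survives depends on the qubit `i` of its factor from `objective δ v`, but not on
whether that factor is `X_i` or `Z_i`, and the coefficients of these two add up to `√2 cos δ`. So
the normalization factor reveals nothing about `v`. -/
theorem normalization_objective {n : ℕ} {δ : ℝ} (hs : 0 ≤ Real.sin δ)
    (hsc : Real.sin δ < Real.cos δ) (q : Query n) (v : Fin n → ℤˣ) :
    q.normalization (objective δ v)
      = ∑ k, ∑ i, genWeight q (k, PauliString.single i .X) * (2 * Real.cos δ / √2) := by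
  simp_rw [Query.normalization, weight_objective hs hsc]
  rw [Fintype.sum_prod_type]
  refine Finset.sum_congr rfl fun k _ => ?_
  simp_rw [amplitude, Finset.mul_sum]
  rw [Finset.sum_comm]
  refine Finset.sum_congr rfl fun i _ => ?_
  simp_rw [mul_add, mul_ite, mul_zero, Finset.sum_add_distrib, Finset.sum_ite_eq',
    Finset.mem_univ, if_true]
  rw [genWeight_congr q k (l := PauliString.single i .Z) (l' := PauliString.single i .X)
      (by rw [qubits_single _ (by simp), qubits_single _ (by simp)]),
    angle, sin_pi_div_four_add, cos_pi_div_four_add]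
  ring

theorem flipDivergenceLE_termLaw {n : ℕ} {δ : ℝ} (hs : 0 ≤ Real.sin δ)
    (hsc : Real.sin δ < Real.cos δ) (q : Query n)
    (h : ∀ v : Fin n → ℤˣ, q.normalization (objective δ v) ≠ 0) :
    FlipDivergenceLE (fun v => q.termLaw (objective δ v) (h v))
      (4 * Real.sin δ ^ 2 / (Real.cos δ ^ 2 - Real.sin δ ^ 2)) := by
  have hN : ∀ v w : Fin n → ℤˣ,
      q.normalization (objective δ v) = q.normalization (objective δ w) := fun v w => by
    rw [normalization_objective hs hsc, normalization_objective hs hsc]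
  have h0 : ∀ v : Fin n → ℤˣ, 0 ≤ q.normalization (objective δ v) := fun v =>
    Finset.sum_nonneg fun t _ => q.weight_nonneg _ t
  have hp : ∀ v t, (q.termLaw (objective δ v) (h v) t).toReal
      = genWeight q t / q.normalization (objective δ v) * amplitude δ v t.2 := by
    intro v t
    rw [Query.termLaw, PMF.ofFintype_apply,
      ENNReal.toReal_ofReal (div_nonneg (q.weight_nonneg _ t) (h0 v)), weight_objective hs hsc]
    ring
  refine .of_chiSq _ ?_ ?_
  · intro v i t ht
    have h1 := hp (flipAt v i) t
    rw [ht, ENNReal.toReal_zero, eq_comm, mul_eq_zero, hN _ v, amplitude_eq_zero_iff hs hsc,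
      ← amplitude_eq_zero_iff hs hsc v, ← mul_eq_zero, ← hp v t, ENNReal.toReal_eq_zero_iff] at h1
    exact h1.resolve_right (PMF.apply_ne_top _ t)
  · intro v
    rw [Finset.sum_comm]
    have e : ∀ c a b : ℝ, (c * a - c * b) ^ 2 / (c * b) = c * ((a - b) ^ 2 / b) := by
      intro c a b
      by_cases hc : c = 0
      · simp [hc]
      · rw [← mul_sub, mul_pow, sq c, mul_assoc, mul_div_mul_left _ _ hc, mul_div_assoc]
    have h1 : ∑ t : q.Term, genWeight q t / q.normalization (objective δ v) * amplitude δ v t.2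
        = 1 := by
      simp_rw [div_mul_eq_mul_div, ← weight_objective hs hsc, ← Finset.sum_div]
      exact div_self (h v)
    simp_rw [hp, hN (flipAt v _) v, e, ← Finset.mul_sum]
    refine (Finset.sum_le_sum fun t _ => mul_le_mul_of_nonneg_left
      (sum_sq_amplitude_sub_div_le hs hsc v t.2)
      (div_nonneg (genWeight_nonneg q t) (h0 v))).trans_eq ?_
    simp_rw [mul_left_comm _ (4 * Real.sin δ ^ 2 / (Real.cos δ ^ 2 - Real.sin δ ^ 2)),
      ← Finset.mul_sum, h1, mul_one]

theorem flipDivergenceLE_oracle {n : ℕ} {δ : ℝ} (hs : 0 ≤ Real.sin δ)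
    (hsc : Real.sin δ < Real.cos δ) (q : Query n) :
    FlipDivergenceLE (fun v : Fin n → ℤˣ => oracle (objective δ v) q)
      (4 * Real.sin δ ^ 2 / (Real.cos δ ^ 2 - Real.sin δ ^ 2)) := by
  have hN : ∀ v : Fin n → ℤˣ,
      q.normalization (objective δ v) = q.normalization (objective δ (1 : Fin n → ℤˣ)) := by
    intro v
    rw [normalization_objective hs hsc, normalization_objective hs hsc]
  by_cases h : q.normalization (objective δ (1 : Fin n → ℤˣ)) = 0
  · simp only [oracle, hN, h, ne_eq, not_true_eq_false, dite_false]
    have hD : 0 ≤ 4 * Real.sin δ ^ 2 / (Real.cos δ ^ 2 - Real.sin δ ^ 2) :=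
      div_nonneg (by positivity) (by nlinarith)
    simpa using FlipDivergenceLE.mono (.pure (0 : ℝ)) hD
  · have h' : ∀ v : Fin n → ℤˣ, q.normalization (objective δ v) ≠ 0 := fun v => by rwa [hN v]
    have e : (fun v : Fin n → ℤˣ => oracle (objective δ v) q) = fun v =>
        (q.termLaw (objective δ v) (h' v)).bind fun t =>
          (PMF.uniformOfFintype (Finset (Fin q.order))).bind fun R =>
            (q.hadamardLaw (objective δ (1 : Fin n → ℤˣ)) t R).bind fun b =>
              PMF.pure
                ((if b then 1 else -1) * q.normalization (objective δ (1 : Fin n → ℤˣ))) := by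
      funext v
      rw [oracle, dif_pos (h' v)]
      simp only [hadamardLaw_objective hs hsc q v 1, hN v]
      rfl
    rw [e]
    have h2 := (flipDivergenceLE_termLaw hs hsc q h').bind fun t =>
      (FlipDivergenceLE.const (PMF.uniformOfFintype (Finset (Fin q.order)))).bind fun R =>
        (FlipDivergenceLE.const (q.hadamardLaw (objective δ (1 : Fin n → ℤˣ)) t R)).bind fun b =>
          .pure ((if b then 1 else -1) * q.normalization (objective δ (1 : Fin n → ℤˣ)))
    simpa only [add_zero] using h2

theorem flipDivergenceLE_outputLaw {n : ℕ} {δ : ℝ} (hs : 0 ≤ Real.sin δ)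
    (hsc : Real.sin δ < Real.cos δ) {T : ℕ} (A : Strategy n T) :
    FlipDivergenceLE (fun v : Fin n → ℤˣ => A.outputLaw (objective δ v))
      (T * (4 * Real.sin δ ^ 2 / (Real.cos δ ^ 2 - Real.sin δ ^ 2))) := by
  have hD : 0 ≤ 4 * Real.sin δ ^ 2 / (Real.cos δ ^ 2 - Real.sin δ ^ 2) :=
    div_nonneg (by positivity) (by nlinarith)
  induction A with
  | output ψ => exact (FlipDivergenceLE.pure ψ).mono (by positivity)
  | ask q next ih =>
    refine ((flipDivergenceLE_oracle hs hsc q).bind ih).mono (le_of_eq ?_)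
    push_cast
    ring

/-! ### The number of wrong guesses -/

theorem correct_mem {n : ℕ} (v : Fin n → ℤˣ) (i : Fin n) (ψ : PureState n) :
    correct v i ψ = 0 ∨ correct v i ψ = 1 := by
  unfold correct
  split_ifs <;> simp

theorem correct_flipAt {n : ℕ} (v : Fin n → ℤˣ) (i : Fin n) (ψ : PureState n) :
    correct (flipAt v i) i ψ = 1 - correct v i ψ := by
  unfold correct
  rw [flipAt_self]
  rcases Int.units_eq_one_or (guess ψ i) with h | h <;>
    rcases Int.units_eq_one_or (v i) with h' | h' <;> simp [h, h']

/-- A state whose law hardly changes when one sign is flipped cannot be used to guess the signs: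
on average over `v`, at least `3n/8 - 2B` of the guesses are wrong. -/
theorem FlipDivergenceLE.le_sum_wrong {n : ℕ} {L : (Fin n → ℤˣ) → PMF (PureState n)} {B : ℝ}
    (h : FlipDivergenceLE L B) :
    ENNReal.ofReal (2 ^ n * (3 * n / 8 - 2 * B))
      ≤ ∑ v, ∑' ψ, L v ψ * ENNReal.ofReal (∑ i, (1 - correct v i ψ)) := by
  obtain ⟨ι, _, y, P, k, hP0, hP1, hPL, hPk, hk⟩ := h
  set E : (Fin n → ℤˣ) → Fin n → ℝ := fun v i => ∑ a, P v a * correct v i (y a) with hE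
  -- The test function is `correct / 4`: `exp (c / 4) ≤ 1 + c / 4 + 1 / 16`, and scaling up by `4`
  -- turns the divergence into `4 * k` and the remainder `1 / 16` into `1 / 4`.
  have h1 : ∀ v i, E v i + E (flipAt v i) i ≤ 5 / 4 + 4 * k v i := by
    intro v i
    have hg := hPk v i fun a => correct v i (y a) / 4
    have hw : ∑ a, P (flipAt v i) a * Real.exp (correct v i (y a) / 4)
        ≤ ∑ a, P (flipAt v i) a * (21 / 16 - correct (flipAt v i) i (y a) / 4) := by
      refine Finset.sum_le_sum fun a _ => mul_le_mul_of_nonneg_left ?_ (hP0 _ _)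
      rw [correct_flipAt]
      rcases correct_mem v i (y a) with hc | hc <;> rw [hc]
      · norm_num
      · have := (abs_le.mp (Real.abs_exp_sub_one_sub_id_le (x := 1 / 4) (by
          rw [abs_of_pos] <;> norm_num))).2
        norm_num at this ⊢
        linarith
    have e1 : ∑ a, P (flipAt v i) a * (21 / 16 - correct (flipAt v i) i (y a) / 4)
        = (5 / 16 - E (flipAt v i) i / 4) + 1 := by
      simp_rw [mul_sub, Finset.sum_sub_distrib, ← Finset.sum_mul, hP1, hE, mul_div_assoc',
        ← Finset.sum_div]
      ring
    have e2 : ∑ a, P v a * (correct v i (y a) / 4) = E v i / 4 := by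
      simp_rw [mul_div_assoc', ← Finset.sum_div, hE]
    rw [e2] at hg
    have h3 := Real.exp_le_exp.mp
      (hg.trans (hw.trans (e1.trans_le (Real.add_one_le_exp _))))
    linarith
  have hcard : Fintype.card (Fin n → ℤˣ) = 2 ^ n := by simp [Fintype.card_units_int]
  have h2 : ∑ v, ∑ i, (E v i + E (flipAt v i) i) ≤ 2 ^ n * (5 * n / 4 + 4 * B) := by
    calc ∑ v, ∑ i, (E v i + E (flipAt v i) i)
        ≤ ∑ _v : Fin n → ℤˣ, (5 * n / 4 + 4 * B) := by
          refine Finset.sum_le_sum fun v _ =>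
            (Finset.sum_le_sum fun i _ => h1 v i).trans ?_
          rw [Finset.sum_add_distrib, ← Finset.mul_sum, Finset.sum_const, Finset.card_univ,
            Fintype.card_fin, nsmul_eq_mul]
          linarith [hk v]
      _ = 2 ^ n * (5 * n / 4 + 4 * B) := by
          rw [Finset.sum_const, Finset.card_univ, hcard, nsmul_eq_mul]
          push_cast
          rfl
  have hflip : ∑ v, ∑ i, E (flipAt v i) i = ∑ v, ∑ i, E v i := by
    rw [Finset.sum_comm, Finset.sum_comm (f := fun v i => E v i)]
    refine Finset.sum_congr rfl fun i _ => ?_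
    exact Equiv.sum_comp
      (Function.Involutive.toPerm (fun v => flipAt v i) fun v => flipAt_flipAt v i) fun v => E v i
  simp_rw [Finset.sum_add_distrib] at h2
  rw [hflip] at h2
  have hnn : ∀ (v : Fin n → ℤˣ) (ψ : PureState n), 0 ≤ ∑ i, (1 - correct v i ψ) := fun v ψ =>
    Finset.sum_nonneg fun i _ => by rcases correct_mem v i ψ with hc | hc <;> simp [hc]
  have h3 : ∑ v, ∑ a, P v a * ∑ i, (1 - correct v i (y a)) = 2 ^ n * n - ∑ v, ∑ i, E v i := by
    have : ∀ v, ∑ a, P v a * ∑ i, (1 - correct v i (y a)) = n - ∑ i, E v i := by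
      intro v
      simp_rw [Finset.sum_sub_distrib, mul_sub, Finset.sum_sub_distrib, ← Finset.sum_mul, hP1]
      rw [hE, Finset.sum_comm]
      simp_rw [Finset.mul_sum]
      simp
    simp_rw [this, Finset.sum_sub_distrib]
    rw [Finset.sum_const, Finset.card_univ, hcard, nsmul_eq_mul]
    push_cast
    rfl
  simp_rw [hPL, ← ENNReal.ofReal_mul (hP0 _ _)]
  simp_rw [← ENNReal.ofReal_sum_of_nonneg fun a (_ : a ∈ Finset.univ) =>
    mul_nonneg (hP0 _ a) (hnn _ (y a))]
  rw [← ENNReal.ofReal_sum_of_nonneg fun v _ =>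
    Finset.sum_nonneg fun a _ => mul_nonneg (hP0 _ a) (hnn _ (y a)), h3]
  exact ENNReal.ofReal_le_ofReal (by linarith)

theorem le_sum_expectedError {n T : ℕ} {δ : ℝ} (hs : 0 ≤ Real.sin δ)
    (hsc : Real.sin δ < Real.cos δ) (A : Strategy n T) :
    ENNReal.ofReal ((1 - Real.cos δ) * (2 ^ n * (3 * n / 8 -
        2 * (T * (4 * Real.sin δ ^ 2 / (Real.cos δ ^ 2 - Real.sin δ ^ 2))))))
      ≤ ∑ v : Fin n → ℤˣ, A.expectedError (objective δ v) := by
  have h0 : 0 ≤ 1 - Real.cos δ := sub_nonneg.mpr (Real.cos_le_one δ)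
  rw [ENNReal.ofReal_mul h0]
  refine (mul_le_mul_right (flipDivergenceLE_outputLaw hs hsc A).le_sum_wrong _).trans ?_
  rw [Finset.mul_sum]
  refine Finset.sum_le_sum fun v _ => ?_
  rw [← ENNReal.tsum_mul_left]
  refine ENNReal.tsum_le_tsum fun ψ => ?_
  rw [mul_left_comm, ← ENNReal.ofReal_mul h0]
  gcongr
  exact le_sandwich_sub_lambdaMin ψ hs (hs.trans hsc.le) v

/-- The lower bound in terms of `δ`, with all trigonometric functions estimated by powers of `δ`. -/
theorem le_of_optimizationError_le {n T : ℕ} {ε δ : ℝ} (hε : 0 < ε) (hδ : 0 < δ)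
    (hδ2 : δ ^ 2 ≤ 0.45) {Ω : Type*} [MeasurableSpace Ω] (μ : Measure Ω) [IsProbabilityMeasure μ]
    (A : Ω → Strategy n T)
    (hA : ∀ v : Fin n → ℤˣ, AEMeasurable (fun ω => (A ω).expectedError (objective δ v)) μ)
    (hle : ∀ v : Fin n → ℤˣ,
      ∫⁻ ω, (A ω).expectedError (objective δ v) ∂μ ≤ ENNReal.ofReal ε) :
    0.4 * δ ^ 2 * (3 * n / 8 - 80 * T * δ ^ 2) ≤ ε := by
  have hδ1 : δ ≤ 0.671 := by nlinarith
  have hs : 0 ≤ Real.sin δ :=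
    Real.sin_nonneg_of_nonneg_of_le_pi hδ.le (by linarith [Real.pi_gt_three])
  have hs' : Real.sin δ ≤ δ := Real.sin_le hδ.le
  have hc := Real.one_sub_sq_div_two_le_cos (x := δ)
  have hsc : Real.sin δ < Real.cos δ := by linarith
  have hcos : 0.4 * δ ^ 2 ≤ 1 - Real.cos δ := by
    have h1 := (abs_le.mp (Real.cos_bound (x := δ) (by rw [abs_of_pos hδ]; linarith))).2
    rw [abs_of_pos hδ] at h1
    have h2 : δ ^ 4 ≤ 0.45 * δ ^ 2 := by nlinarith [sq_nonneg δ]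
    linarith
  have hD : 4 * Real.sin δ ^ 2 / (Real.cos δ ^ 2 - Real.sin δ ^ 2) ≤ 40 * δ ^ 2 := by
    have h1 : Real.sin δ ^ 2 ≤ δ ^ 2 := pow_le_pow_left₀ hs hs' 2
    have h2 : (0.1 : ℝ) ≤ Real.cos δ ^ 2 - Real.sin δ ^ 2 := by
      linarith [Real.sin_sq_add_cos_sq δ]
    rw [div_le_iff₀ (by linarith)]
    nlinarith [sq_nonneg δ]
  have hT : T * (4 * Real.sin δ ^ 2 / (Real.cos δ ^ 2 - Real.sin δ ^ 2)) ≤ T * (40 * δ ^ 2) :=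
    mul_le_mul_of_nonneg_left hD (Nat.cast_nonneg T)
  rcases le_or_gt (3 * n / 8 - 80 * T * δ ^ 2) 0 with hneg | hpos
  · exact (mul_nonpos_of_nonneg_of_nonpos (by positivity) hneg).trans hε.le
  have hmain : ENNReal.ofReal ((1 - Real.cos δ) * (2 ^ n * (3 * n / 8 -
        2 * (T * (4 * Real.sin δ ^ 2 / (Real.cos δ ^ 2 - Real.sin δ ^ 2))))))
      ≤ ENNReal.ofReal (2 ^ n * ε) := by
    calc _ = ∫⁻ _ω, ENNReal.ofReal ((1 - Real.cos δ) * (2 ^ n * (3 * n / 8 -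
          2 * (T * (4 * Real.sin δ ^ 2 / (Real.cos δ ^ 2 - Real.sin δ ^ 2)))))) ∂μ := by
          simp
      _ ≤ ∫⁻ ω, ∑ v : Fin n → ℤˣ, (A ω).expectedError (objective δ v) ∂μ :=
          lintegral_mono fun ω => le_sum_expectedError hs hsc (A ω)
      _ = ∑ v : Fin n → ℤˣ, ∫⁻ ω, (A ω).expectedError (objective δ v) ∂μ :=
          lintegral_finsetSum' _ fun v _ => hA v
      _ ≤ ∑ _v : Fin n → ℤˣ, ENNReal.ofReal ε := Finset.sum_le_sum fun v _ => hle v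
      _ = ENNReal.ofReal (2 ^ n * ε) := by
          rw [Finset.sum_const, Finset.card_univ, ENNReal.ofReal_mul (by positivity),
            nsmul_eq_mul]
          simp [Fintype.card_units_int, ENNReal.ofReal_pow]
  rw [ENNReal.ofReal_le_ofReal_iff (by positivity), mul_left_comm] at hmain
  have h3 := le_of_mul_le_mul_left hmain (by positivity)
  refine le_trans (mul_le_mul hcos ?_ hpos.le (by linarith [sq_nonneg δ])) h3
  linarith

end Variational

end

theorem mainTheorem2 :
    ∃ c : ℝ, 0 < c ∧
      ∀ (n : ℕ) (ε : ℝ), 15 ≤ n → 0 < ε → ε ≤ 0.01 * (n : ℝ) →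
      ∀ (T : ℕ) (Ω : Type*) [MeasurableSpace Ω] (μ : MeasureTheory.Measure Ω)
        [MeasureTheory.IsProbabilityMeasure μ] (A : Ω → Variational.Strategy n T),
        (∀ H ∈ Variational.family n ε, AEMeasurable (fun ω => (A ω).expectedError H) μ) →
        Variational.optimizationError μ A (Variational.family n ε) ≤ ENNReal.ofReal ε →
        c * ((n : ℝ) ^ 2 / ε) ≤ (T : ℝ) := by
  refine ⟨1 / 12000, by norm_num, ?_⟩
  intro n ε hn hε hεn T Ω _ μ _ A hA hle
  have hn0 : (0 : ℝ) < n := by exact_mod_cast (by omega : 0 < n)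
  have hδ2 : Variational.bias n ε ^ 2 = 45 * ε / n := Real.sq_sqrt (by positivity)
  have h := Variational.le_of_optimizationError_le hε (Real.sqrt_pos.mpr (by positivity))
    (by rw [← Variational.bias, hδ2, div_le_iff₀ hn0]; linarith) μ A (fun v => hA _ ⟨v, rfl⟩)
    (fun v => (le_iSup₂ (f := fun H _ => ∫⁻ ω, (A ω).expectedError H ∂μ) _
      (Set.mem_range_self v)).trans hle)
  rw [← Variational.bias, hδ2] at h
  have e : 0.4 * (45 * ε / n) * (3 * n / 8 - 80 * T * (45 * ε / n))
      = ε * (18 * (3 / 8 - 3600 * T * ε / n ^ 2)) := by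
    field_simp
    ring
  rw [e] at h
  have h1 : 18 * (3 / 8 - 3600 * T * ε / (n : ℝ) ^ 2) ≤ 1 :=
    le_of_mul_le_mul_left (by simpa using h) hε
  have h2 : 0.3 ≤ 3600 * T * ε / (n : ℝ) ^ 2 := by linarith
  rw [le_div_iff₀ (by positivity)] at h2
  rw [mul_div_assoc', div_le_iff₀ hε]
  linarith
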